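/- Throughout, $\log$ is the logarithm to base $2$. For a family $\mathcal F\subseteq 2^{[n]}$ let $\mathrm{supp}(\mathcal F)=\bigcup_{S\in\mathcal F}S$ and, for $J\subseteq[n]$, $\mathcal F_J=\{S\cap J: S\in\mathcal F\}$. Sets $S_1,\dots,S_k\subseteq[n]$ form a $k$-moonflower if there is $I\subseteq[n]$ such that the sets $S_i\setminus I$ are nonempty and pairwise disjoint; $\mathcal F$ is $k$-moonflower-free if it contains no $k$-moonflower. A $w$-set is a set of size at most $w$. A family $\mathcal G\subseteq 2^{[n]}$ is $p$-covered if there is a probability distribution $Q$ on $[n]$ with $\sum_{i\in S}Q(i)\ge p$ for every $S\in\mathcal G$; and $\mathcal F$ is $(p,M)$-almost-covered if for every $J\subseteq[n]$ there is $\mathcal S_J\subseteq\mathcal F_J$ with $|\mathcal S_J|\le M$ such that $\mathcal F_J\setminus\mathcal S_J$ is $p$-covered. **Lemma.** There is an absolute constant $B\ge 1$ such that the following holds. Let $1\le k\le n$, $w\ge 0$ be integers, let $p\in(0,1)$, and let $\mathcal F\subseteq 2^{[n]}$ be a $k$-moonflower-free family of $w$-sets with $|\mathrm{supp}(\mathcal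 F)|=n$. 1. If $n\ge 2k$ and $p\le 1/2$, then $\mathcal F$ is $(p,2^{h})$-almost-covered with $$h=B\cdot k\log\Big(\frac nk\Big)\cdot p\log(1/p).$$ 2. In all cases, $\mathcal F$ is $(p,2^{h'})$-almost-covered with $$h'=B\cdot k\log\Big(\frac{en}{k}\Big)\cdot p\log(2/p).$$ -/

import Mathlib

namespace Moonflower

variable {α : Type*} [DecidableEq α]

/-- The support of a family of sets: the union of its members. -/
def supp (F : Finset (Finset α)) : Finset α := F.biUnion id

/-- `S 0, …, S (k-1)` is a `k`-moonflower: for some set `I` the sets `S i \ I` are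
nonempty and pairwise disjoint. -/
def IsMoonflower {k : ℕ} (S : Fin k → Finset α) : Prop :=
  ∃ I : Finset α, (∀ i, (S i \ I).Nonempty) ∧ ∀ i j, i ≠ j → Disjoint (S i \ I) (S j \ I)

/-- `F` contains no `k`-moonflower. (The members of a moonflower are automatically distinct.) -/
def MoonflowerFree (k : ℕ) (F : Finset (Finset α)) : Prop :=
  ∀ S : Fin k → Finset α, (∀ i, S i ∈ F) → ¬ IsMoonflower S

/-- The projection (trace) `F_J = {S ∩ J : S ∈ F}`. -/
def proj (F : Finset (Finset α)) (J : Finset α) : Finset (Finset α) :=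
  F.image fun S => S ∩ J

/-- `G` is `p`-covered: some probability distribution `Q` on the ground set gives every
member of `G` mass at least `p`. -/
def PCovered [Fintype α] (p : ℝ) (G : Finset (Finset α)) : Prop :=
  ∃ Q ∈ stdSimplex ℝ α, ∀ S ∈ G, p ≤ ∑ i ∈ S, Q i

/-- `F` is `(p, M)`-almost-covered: each projection is `p`-covered after the removal of at
most `M` of its sets. -/
def AlmostCovered [Fintype α] (p M : ℝ) (F : Finset (Finset α)) : Prop :=
  ∀ J : Finset α, ∃ E ⊆ proj F J, (E.card : ℝ) ≤ M ∧ PCovered p (proj F J \ E)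

end Moonflower

/-!
Call `T` a tip set of a family if each point of `T` is the only point of `T` in some member. In a
`k`-moonflower-free family, and hence in its projections, every tip set has fewer than `k` points.

By minimax there is a distribution `Q` such that `#T ≤ 4 k Q(supp E)` for all subfamilies `E` of the
projection and all tip sets `T` of `E`. Otherwise some distribution on the pairs `(E, T)` would
cover every point by `supp E` with probability less than `τ / (4 k)`, where `τ` is the expected
size of `T`. Sample about `2 k / τ` pairs independently and keep those points of each `T` that
avoid the other supports: they form a tip set, whose expected size would exceed `k`.

It remains to count the sets of `Q`-mass less than `p`. A nonempty one has a tip set of size one, so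
there is none if `4 k p < 1`. If a family `E` of such sets has support of mass `w ≥ 4 p`, then some
`E' ⊆ E` with at least `exp (-64 k p) / 2 * #E` members has support of mass at most `w / 2`. To see
this, draw slightly more than `32 k w` points from `Q`, biased by the number of members of `E` that
avoid them all. The sampled points lying in the support of the members that avoid all the other
samples form a tip set, so there are at most `4 k w` of them. If every large subfamily had support
of mass more than `w / 2`, there would on average be more. After about `log (1 / p)` halvings the
support has mass at most `4 p`; then tip sets, in particular shattered sets, have at most `16 k p`
points, and the Sauer–Shelah lemma bounds the number of sets.
-/

namespace Moonflower

open Finset Matrix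

theorem exists_stdSimplex_le_mulVec_or_vecMul_lt {m n : Type*} [Fintype m] [Fintype n]
    [Nonempty m] [Nonempty n] (A : Matrix m n ℝ) (c : ℝ) :
    (∃ y ∈ stdSimplex ℝ n, ∀ i, c ≤ (A *ᵥ y) i) ∨ ∃ x ∈ stdSimplex ℝ m, ∀ j, (x ᵥ* A) j < c := by
  classical
  let f : (m → ℝ) →ₗ[ℝ] (n → ℝ) →ₗ[ℝ] ℝ := toLinearMap₂' ℝ A
  obtain ⟨x, hx, y, hy, hxy⟩ := Sion.exists_isSaddlePointOn (f := fun x y => f x y)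
    ⟨_, single_mem_stdSimplex ℝ (Classical.arbitrary m)⟩
    (convex_stdSimplex ℝ m) (isCompact_stdSimplex ℝ m)
    (fun y _ =>
      (f.flip y).continuous_of_finiteDimensional.lowerSemicontinuous.lowerSemicontinuousOn _)
    (fun y _ => ((f.flip y).convexOn (convex_stdSimplex ℝ m)).quasiconvexOn)
    (convex_stdSimplex ℝ n) ⟨_, single_mem_stdSimplex ℝ (Classical.arbitrary n)⟩
    (isCompact_stdSimplex ℝ n)
    (fun x _ => (f x).continuous_of_finiteDimensional.upperSemicontinuous.upperSemicontinuousOn _)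
    (fun x _ => ((f x).concaveOn (convex_stdSimplex ℝ n)).quasiconcaveOn)
  rcases le_or_gt c (f x y) with hc | hc
  · refine Or.inl ⟨y, hy, fun i => hc.trans ?_⟩
    simpa [f, toLinearMap₂'_apply'] using hxy _ (single_mem_stdSimplex ℝ i) y hy
  · refine Or.inr ⟨x, hx, fun j => lt_of_le_of_lt ?_ hc⟩
    have hj := hxy x hx _ (single_mem_stdSimplex ℝ j)
    simpa only [f, toLinearMap₂'_apply', dotProduct_mulVec, dotProduct_single_one] using hj

theorem sum_prod_mul_removeNth {β R : Type*} [Fintype β] [CommSemiring R] {r : ℕ} (i : Fin (r + 1))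
    (q : β → R) (g : β → (Fin r → β) → R) :
    ∑ x : Fin (r + 1) → β, (∏ j, q (x j)) * g (x i) (i.removeNth x) =
      ∑ t : Fin r → β, (∏ j, q (t j)) * ∑ y, q y * g y t := by
  rw [← (Fin.insertNthEquiv (fun _ => β) i).sum_comp, Fintype.sum_prod_type_right]
  refine sum_congr rfl fun t _ => ?_
  rw [mul_sum]
  refine sum_congr rfl fun y _ => ?_
  have hrem : i.removeNth (Fin.insertNthEquiv (fun _ => β) i (y, t)) = t :=
    Fin.removeNth_insertNth ..
  simp only [hrem, Fin.insertNthEquiv_apply, Fin.prod_univ_succAbove _ i, Fin.insertNth_apply_same,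
    Fin.insertNth_apply_succAbove]
  ring

theorem exists_nat_lt_succ_mul_one_sub_pow {D τ : ℝ} (hτ : 0 < τ) (hτD : τ ≤ D) :
    ∃ r : ℕ, D < (r + 1) * (τ * (1 - τ / (4 * D)) ^ r) := by
  have hD : 0 < D := hτ.trans_le hτD
  have hle : τ / (4 * D) ≤ 1 := by rw [div_le_one (by positivity)]; linarith
  refine ⟨⌊2 * D / τ⌋₊, ?_⟩
  set r := ⌊2 * D / τ⌋₊
  have hr : r * (τ / (4 * D)) ≤ 1 / 2 := by
    calc r * (τ / (4 * D)) ≤ 2 * D / τ * (τ / (4 * D)) := by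
          gcongr
          exact Nat.floor_le (by positivity)
      _ = 1 / 2 := by field_simp; norm_num
  have hpow : 1 / 2 ≤ (1 - τ / (4 * D)) ^ r := by
    have bernoulli := one_add_mul_le_pow (a := -(τ / (4 * D))) (by linarith) r
    rw [← sub_eq_add_neg] at bernoulli
    linarith
  calc D = 2 * D / τ * (τ * (1 / 2)) := by field_simp
    _ < (r + 1) * (τ * (1 / 2)) := by gcongr; exact Nat.lt_floor_add_one _
    _ ≤ (r + 1) * (τ * (1 - τ / (4 * D)) ^ r) := by gcongr

theorem sum_prod_mul_card_filter_forall {ι β R : Type*} [Fintype ι] [CommSemiring R] (X : Finset β)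
    (P : β → ι → Prop) [∀ x, DecidablePred (P x)] (q : ι → R) (r : ℕ) :
    ∑ t : Fin r → ι, (∏ j, q (t j)) * #{x ∈ X | ∀ j, P x (t j)} =
      ∑ x ∈ X, (∑ i with P x i, q i) ^ r := by
  simp only [sum_filter, Fintype.sum_pow, prod_ite_zero, card_filter, Nat.cast_sum, mul_sum]
  rw [sum_comm]
  simp

theorem sum_choose_Iic_le (n d : ℕ) {l : ℝ} (hl : 0 < l) (hl1 : l ≤ 1) :
    ∑ i ∈ Iic d, (n.choose i : ℝ) ≤ Real.exp (d * Real.log (1 / l) + l * n) := by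
  have hbinom : (∑ i ∈ Iic d, (n.choose i : ℝ)) * l ^ d ≤ (1 + l) ^ n := by
    calc (∑ i ∈ Iic d, (n.choose i : ℝ)) * l ^ d
        ≤ ∑ i ∈ Iic d, n.choose i * l ^ i := by
          rw [sum_mul]
          refine sum_le_sum fun i hi => ?_
          gcongr _ * ?_
          exact pow_le_pow_of_le_one hl.le hl1 (mem_Iic.1 hi)
      _ ≤ ∑ i ∈ Iic d ∪ range (n + 1), n.choose i * l ^ i :=
          sum_le_sum_of_subset_of_nonneg subset_union_left fun i _ _ => by positivity
      _ = ∑ i ∈ range (n + 1), n.choose i * l ^ i := by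
          refine (sum_subset subset_union_right fun i _ hi => ?_).symm
          rw [Nat.choose_eq_zero_of_lt (by simpa using hi)]
          simp
      _ = (1 + l) ^ n := by
          rw [add_comm 1 l, add_pow]
          exact sum_congr rfl fun i _ => by rw [one_pow, mul_one, mul_comm]
  calc ∑ i ∈ Iic d, (n.choose i : ℝ) ≤ (1 + l) ^ n / l ^ d := (le_div_iff₀ (by positivity)).2 hbinom
    _ ≤ Real.exp l ^ n * (1 / l) ^ d := by
        rw [one_div, inv_pow, ← div_eq_mul_inv]
        gcongr
        linarith [Real.add_one_le_exp l]
    _ = Real.exp (d * Real.log (1 / l) + l * n) := by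
        rw [add_comm, Real.exp_add, mul_comm l, Real.exp_nat_mul, Real.exp_nat_mul,
          Real.exp_log (by positivity)]

variable {α : Type*} [DecidableEq α]

/-- `T` is a tip set of `G` if each of its points is the only point of `T` in some member of `G`.
Choosing a point in each `S i \ I` turns a `k`-moonflower into a tip set of size `k`; conversely
the complement of a tip set serves as `I`. -/
def IsTipSet (G : Finset (Finset α)) (T : Finset α) : Prop :=
  ∀ x ∈ T, ∃ S ∈ G, S ∩ T = {x}

theorem subset_supp_of_mem {G : Finset (Finset α)} {S : Finset α} (hS : S ∈ G) : S ⊆ supp G :=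
  subset_biUnion_of_mem id hS

theorem supp_mono {E G : Finset (Finset α)} (h : E ⊆ G) : supp E ⊆ supp G :=
  biUnion_subset_biUnion_of_subset_left id h

theorem isTipSet_empty (G : Finset (Finset α)) : IsTipSet G ∅ := by
  simp [IsTipSet]

theorem isTipSet_of_shatters {G : Finset (Finset α)} {T : Finset α} (h : G.Shatters T) :
    IsTipSet G T := fun x hx => by
  obtain ⟨S, hS, hST⟩ := h (singleton_subset_iff.2 hx)
  exact ⟨S, hS, by rw [inter_comm, hST]⟩

theorem IsTipSet.mono {E G : Finset (Finset α)} {T : Finset α} (h : IsTipSet E T) (hEG : E ⊆ G) :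
    IsTipSet G T := fun x hx => (h x hx).imp fun _ hS => ⟨hEG hS.1, hS.2⟩

theorem IsTipSet.subset {G : Finset (Finset α)} {T T' : Finset α} (h : IsTipSet G T)
    (hT' : T' ⊆ T) : IsTipSet G T' := fun x hx => by
  obtain ⟨S, hS, hST⟩ := h x (hT' hx)
  refine ⟨S, hS, ?_⟩
  rw [← inter_eq_right.2 hT', ← inter_assoc, hST, singleton_inter_of_mem hx]

theorem IsTipSet.subset_supp {G : Finset (Finset α)} {T : Finset α} (h : IsTipSet G T) :
    T ⊆ supp G := fun x hx => by
  obtain ⟨S, hS, hST⟩ := h x hx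
  exact subset_supp_of_mem hS (mem_of_mem_inter_left (hST ▸ mem_singleton_self x))

theorem IsTipSet.of_proj {F : Finset (Finset α)} {J T : Finset α} (h : IsTipSet (proj F J) T) :
    IsTipSet F T := by
  have hTJ : T ⊆ J := h.subset_supp.trans <| biUnion_subset.2 fun R hR => by
    obtain ⟨S, -, rfl⟩ := mem_image.1 hR
    exact inter_subset_right
  intro x hx
  obtain ⟨R, hR, hRT⟩ := h x hx
  obtain ⟨S, hS, rfl⟩ := mem_image.1 hR
  exact ⟨S, hS, by rw [← hRT, inter_assoc, inter_eq_right.2 hTJ]⟩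

theorem MoonflowerFree.card_lt_of_isTipSet {k : ℕ} {F : Finset (Finset α)}
    (hF : MoonflowerFree k F) {T : Finset α} (hT : IsTipSet F T) : #T < k := by
  by_contra! hk
  obtain ⟨T', hT'T, hT'k⟩ := exists_subset_card_eq hk
  choose! S hSF hST using hT
  let x : Fin k → α := fun i => (T'.equivFin.symm (i.cast hT'k.symm) : α)
  have hxT : ∀ i, x i ∈ T := fun i => hT'T (T'.equivFin.symm _).2
  have hx : Function.Injective x := fun i j h => by
    simpa using T'.equivFin.symm.injective (Subtype.ext h)
  have hdiff : ∀ i, S (x i) \ (supp F \ T) = {x i} := fun i => by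
    rw [← hST _ (hxT i), sdiff_sdiff_right',
      sdiff_eq_empty_iff_subset.2 (subset_supp_of_mem (hSF _ (hxT i)))]
    simp
  refine hF (fun i => S (x i)) (fun i => hSF _ (hxT i)) ⟨supp F \ T, fun i => ?_, fun i j hij => ?_⟩
  · rw [hdiff]
    exact singleton_nonempty _
  · rw [hdiff, hdiff, disjoint_singleton]
    exact hx.ne hij

theorem isTipSet_biUnion {ι : Type*} {G : Finset (Finset α)} {E : ι → Finset (Finset α)}
    {T : ι → Finset α} (s : Finset ι) (hE : ∀ i, E i ⊆ G) (hT : ∀ i, IsTipSet (E i) (T i))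
    (hdisj : ∀ i j, i ≠ j → Disjoint (T i) (supp (E j))) : IsTipSet G (s.biUnion T) := by
  intro x hx
  obtain ⟨i, hi, hxi⟩ := mem_biUnion.1 hx
  obtain ⟨S, hS, hST⟩ := hT i x hxi
  refine ⟨S, hE i hS, ?_⟩
  have hother : ∀ j ∈ s, j ≠ i → S ∩ T j = ∅ := fun j _ hji =>
    disjoint_iff_inter_eq_empty.1 ((hdisj j i hji).mono_right (subset_supp_of_mem hS)).symm
  rw [inter_biUnion, ← hST]
  exact (biUnion_subset.2 fun j hj => by
    rcases eq_or_ne j i with rfl | hji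
    · rfl
    · simp [hother j hj hji]).antisymm (subset_biUnion_of_mem (fun j => S ∩ T j) hi)

theorem sum_card_le_of_isTipSet {ι : Type*} {G : Finset (Finset α)} {D : ℝ}
    (hG : ∀ T, IsTipSet G T → #T ≤ D) {E : ι → Finset (Finset α)} {T : ι → Finset α}
    (s : Finset ι) (hE : ∀ i, E i ⊆ G) (hT : ∀ i, IsTipSet (E i) (T i))
    (hdisj : ∀ i j, i ≠ j → Disjoint (T i) (supp (E j))) : ∑ i ∈ s, (#(T i) : ℝ) ≤ D := by
  have hpair : (s : Set ι).PairwiseDisjoint T := fun i _ j _ hij =>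
    (hdisj i j hij).mono_right (hT j).subset_supp
  simpa [card_biUnion hpair] using hG _ (isTipSet_biUnion s hE hT hdisj)

theorem succ_mul_sum_mul_card_mul_pow_le {ι : Type*} [Fintype ι] {G : Finset (Finset α)} {D : ℝ}
    (hG : ∀ T, IsTipSet G T → #T ≤ D) {E : ι → Finset (Finset α)} {T : ι → Finset α}
    (hE : ∀ i, E i ⊆ G) (hT : ∀ i, IsTipSet (E i) (T i)) {l : ι → ℝ} (hl : l ∈ stdSimplex ℝ ι)
    {β : ℝ} (hβ : 0 ≤ β) (hlβ : ∀ x, β ≤ ∑ i with x ∉ supp (E i), l i) (r : ℕ) :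
    (r + 1) * ((∑ i, l i * #(T i)) * β ^ r) ≤ D := by
  let own (i : ι) (t : Fin r → ι) : Finset α := {x ∈ T i | ∀ j, x ∉ supp (E (t j))}
  have hown (s : Fin (r + 1) → ι) : ∑ j, (#(own (s j) (j.removeNth s)) : ℝ) ≤ D := by
    refine sum_card_le_of_isTipSet hG univ (fun j => hE (s j))
      (fun j => (hT (s j)).subset (filter_subset _ _)) fun i j hij => disjoint_left.2 fun x hx => ?_
    obtain ⟨j, rfl⟩ := Fin.exists_succAbove_eq hij.symm
    exact (mem_filter.1 hx).2 j
  have hβown (i : ι) : #(T i) * β ^ r ≤ ∑ t : Fin r → ι, (∏ j, l (t j)) * #(own i t) := by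
    rw [sum_prod_mul_card_filter_forall (T i) fun x i => x ∉ supp (E i), ← nsmul_eq_mul]
    exact card_nsmul_le_sum _ _ _ fun x _ => pow_le_pow_left₀ hβ (hlβ x) r
  calc (r + 1) * ((∑ i, l i * #(T i)) * β ^ r)
      = ∑ _j : Fin (r + 1), ∑ i, l i * (#(T i) * β ^ r) := by
        simp [sum_mul, mul_assoc]
    _ ≤ ∑ _j : Fin (r + 1), ∑ i, l i * ∑ t : Fin r → ι, (∏ j, l (t j)) * #(own i t) := by
        gcongr with _ _ i
        · exact hl.1 i
        · exact hβown i
    _ = ∑ j, ∑ s : Fin (r + 1) → ι, (∏ j, l (s j)) * #(own (s j) (j.removeNth s)) := by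
        refine sum_congr rfl fun j _ => ?_
        rw [sum_prod_mul_removeNth j l fun i t => (#(own i t) : ℝ)]
        simp only [mul_sum]
        rw [sum_comm]
        simp only [mul_left_comm]
    _ ≤ ∑ s : Fin (r + 1) → ι, (∏ j, l (s j)) * D := by
        rw [sum_comm]
        simp only [← mul_sum]
        gcongr with s
        · exact prod_nonneg fun j _ => hl.1 _
        · exact hown s
    _ = D := by rw [← sum_mul, ← Fintype.sum_pow, hl.2, one_pow, one_mul]

theorem exists_sum_mul_card_le_of_isTipSet [Nonempty α] {ι : Type*} [Fintype ι]
    {G : Finset (Finset α)} {D : ℝ} (hG : ∀ T, IsTipSet G T → #T ≤ D) {E : ι → Finset (Finset α)}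
    {T : ι → Finset α} (hE : ∀ i, E i ⊆ G) (hT : ∀ i, IsTipSet (E i) (T i)) {l : ι → ℝ}
    (hl : l ∈ stdSimplex ℝ ι) :
    ∃ y, ∑ i, l i * #(T i) ≤ 4 * D * ∑ i with y ∈ supp (E i), l i := by
  by_contra! hcov
  set τ := ∑ i, l i * #(T i)
  have hD : 0 ≤ D := by simpa using hG ∅ (isTipSet_empty G)
  have hτ : 0 < τ := (mul_nonneg (by positivity) (sum_nonneg fun i _ => hl.1 i)).trans_lt
    (hcov (Classical.arbitrary α))
  have hτD : τ ≤ D := by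
    calc τ ≤ ∑ i, l i * D :=
          sum_le_sum fun i _ => mul_le_mul_of_nonneg_left (hG _ ((hT i).mono (hE i))) (hl.1 i)
      _ = D := by rw [← sum_mul, hl.2, one_mul]
  have hD' : 0 < D := hτ.trans_le hτD
  obtain ⟨r, hr⟩ := exists_nat_lt_succ_mul_one_sub_pow hτ hτD
  refine hr.not_ge (succ_mul_sum_mul_card_mul_pow_le hG hE hT hl ?_ (fun y => ?_) r)
  · rw [sub_nonneg, div_le_one (by positivity)]
    linarith
  · have hsplit := sum_filter_add_sum_filter_not univ (fun i => y ∈ supp (E i)) l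
    have hlt : ∑ i with y ∈ supp (E i), l i < τ / (4 * D) :=
      (lt_div_iff₀' (by positivity)).2 (hcov y)
    linarith [hl.2]

theorem exists_stdSimplex_forall_isTipSet [Fintype α] [Nonempty α] {G : Finset (Finset α)} {D : ℝ}
    (hG : ∀ T, IsTipSet G T → #T ≤ D) :
    ∃ Q ∈ stdSimplex ℝ α, ∀ E ⊆ G, ∀ T, IsTipSet E T → #T ≤ 4 * D * ∑ y ∈ supp E, Q y := by
  classical
  let ι := {s : Finset (Finset α) × Finset α // s.1 ⊆ G ∧ IsTipSet s.1 s.2}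
  have : Nonempty ι := ⟨⟨(∅, ∅), empty_subset _, isTipSet_empty _⟩⟩
  let A : Matrix ι α ℝ := fun s y => 4 * D * (if y ∈ supp s.1.1 then 1 else 0) - #s.1.2
  rcases exists_stdSimplex_le_mulVec_or_vecMul_lt A 0 with ⟨Q, hQ, hA⟩ | ⟨l, hl, hA⟩
  · refine ⟨Q, hQ, fun E hE T hT => ?_⟩
    have hET := hA ⟨(E, T), hE, hT⟩
    simp only [A, mulVec, dotProduct, sub_mul, sum_sub_distrib, ← mul_sum, hQ.2, mul_assoc,
      ite_mul, one_mul, zero_mul, sum_ite_mem, univ_inter] at hET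
    linarith
  · obtain ⟨y, hy⟩ := exists_sum_mul_card_le_of_isTipSet hG (fun s : ι => s.2.1)
      (fun s => s.2.2) hl
    have hAy := hA y
    simp only [A, vecMul, dotProduct, mul_sub, sum_sub_distrib, mul_ite, mul_one, mul_zero,
      ← sum_filter, ← sum_mul] at hAy
    linarith

/-- The members of `E` that contain none of the points `t j`. -/
def avoiding {r : ℕ} (E : Finset (Finset α)) (t : Fin r → α) : Finset (Finset α) :=
  {S ∈ E | ∀ j, t j ∉ S}

theorem avoiding_subset {r : ℕ} (E : Finset (Finset α)) (t : Fin r → α) : avoiding E t ⊆ E :=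
  filter_subset _ _

theorem notMem_supp_avoiding {r : ℕ} (E : Finset (Finset α)) (t : Fin r → α) (j : Fin r) :
    t j ∉ supp (avoiding E t) := by
  simp only [supp, avoiding, id, mem_biUnion, mem_filter, not_exists, not_and]
  exact fun S hS => hS.2 j

theorem filter_notMem_avoiding_removeNth {r : ℕ} (E : Finset (Finset α)) (x : Fin (r + 1) → α)
    (i : Fin (r + 1)) : {S ∈ avoiding E (i.removeNth x) | x i ∉ S} = avoiding E x := by
  ext S
  simp only [avoiding, mem_filter]
  rw [Fin.forall_iff_succAbove i, and_assoc, and_comm (a := x i ∉ S)]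
  rfl

theorem isTipSet_singleton_inter_supp (G : Finset (Finset α)) (x : α) :
    IsTipSet G ({x} ∩ supp G) := fun y hy => by
  obtain ⟨hyx, hyG⟩ := mem_inter.1 hy
  obtain rfl := mem_singleton.1 hyx
  obtain ⟨S, hS, hyS⟩ := mem_biUnion.1 hyG
  rw [singleton_inter_of_mem hyG]
  exact ⟨S, hS, inter_singleton_of_mem hyS⟩

theorem sum_card_inter_supp_avoiding_le {E : Finset (Finset α)} {D : ℝ}
    (hE : ∀ T, IsTipSet E T → #T ≤ D) {r : ℕ} (x : Fin (r + 1) → α) :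
    ∑ i, (#({x i} ∩ supp (avoiding E (i.removeNth x))) : ℝ) ≤ D := by
  refine sum_card_le_of_isTipSet hE univ (fun i => avoiding_subset E (i.removeNth x))
    (fun i => isTipSet_singleton_inter_supp _ (x i)) fun i j hij => ?_
  obtain ⟨i, rfl⟩ := Fin.exists_succAbove_eq hij
  exact disjoint_of_subset_left inter_subset_left
    (disjoint_singleton_left.2 (notMem_supp_avoiding E (j.removeNth x) i))

theorem sum_sum_supp_sdiff_eq [Fintype α] (G : Finset (Finset α)) (Q : α → ℝ) :
    ∑ S ∈ G, ∑ y ∈ supp G \ S, Q y = ∑ y, Q y * (#{S ∈ G | y ∉ S} * #({y} ∩ supp G)) := by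
  have hcard (y : α) : (#({y} ∩ supp G) : ℝ) = if y ∈ supp G then 1 else 0 := by
    split_ifs with hy <;> simp [hy]
  simp only [hcard, mul_ite, mul_one, mul_zero, sum_ite_mem, univ_inter, sdiff_eq_filter,
    sum_filter]
  rw [sum_comm]
  refine sum_congr rfl fun y _ => ?_
  rw [← sum_filter, sum_const, nsmul_eq_mul, mul_comm]

theorem succ_mul_sum_avoiding_le [Fintype α] {E : Finset (Finset α)} {D : ℝ}
    (hE : ∀ T, IsTipSet E T → #T ≤ D) {Q : α → ℝ} (hQ : ∀ y, 0 ≤ Q y) (r : ℕ) :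
    (r + 1) * ∑ t : Fin r → α, (∏ j, Q (t j)) *
        ∑ S ∈ avoiding E t, ∑ y ∈ supp (avoiding E t) \ S, Q y ≤
      D * ∑ t : Fin r → α, (∏ j, Q (t j)) * ((∑ y, Q y) * #(avoiding E t)) := by
  have hprod (x : Fin (r + 1) → α) : 0 ≤ ∏ j, Q (x j) := prod_nonneg fun j _ => hQ _
  let g (y : α) (t : Fin r → α) : ℝ :=
    #{S ∈ avoiding E t | y ∉ S} * #({y} ∩ supp (avoiding E t))
  -- A sample `x` of `r + 1` points gets the extra weight `#(avoiding E x)`. In terms of `x i` and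
  -- the other points `t` this weight is `#{S ∈ avoiding E t | x i ∉ S}`, so that drawing `x i`
  -- counts the points of `supp (avoiding E t)` outside each `S`.
  calc (r + 1) * ∑ t : Fin r → α, (∏ j, Q (t j)) *
        ∑ S ∈ avoiding E t, ∑ y ∈ supp (avoiding E t) \ S, Q y
      = ∑ i, ∑ x : Fin (r + 1) → α, (∏ j, Q (x j)) * g (x i) (i.removeNth x) := by
        simp only [sum_sum_supp_sdiff_eq, sum_prod_mul_removeNth _ Q g, g, sum_const, card_univ,
          Fintype.card_fin, nsmul_eq_mul, Nat.cast_add, Nat.cast_one]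
    _ = ∑ x : Fin (r + 1) → α, (∏ j, Q (x j)) *
          (#(avoiding E x) * ∑ i, (#({x i} ∩ supp (avoiding E (i.removeNth x))) : ℝ)) := by
        rw [sum_comm]
        simp only [g, filter_notMem_avoiding_removeNth, mul_sum]
    _ ≤ ∑ x : Fin (r + 1) → α, (∏ j, Q (x j)) * (#(avoiding E (Fin.removeNth 0 x)) * D) := by
        gcongr with x
        · exact hprod x
        · rw [← filter_notMem_avoiding_removeNth E x 0]
          exact filter_subset _ _
        · exact sum_card_inter_supp_avoiding_le hE x
    _ = D * ∑ t : Fin r → α, (∏ j, Q (t j)) * ((∑ y, Q y) * #(avoiding E t)) := by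
        rw [sum_prod_mul_removeNth 0 Q fun _ t => (#(avoiding E t) * D : ℝ), mul_sum]
        simp only [← sum_mul]
        exact sum_congr rfl fun t _ => by ring

theorem mul_card_sub_le_sum_sum_supp_sdiff {E : Finset (Finset α)} {Q : α → ℝ}
    (hQ : ∀ y, 0 ≤ Q y) {p w A N : ℝ} (hw : 4 * p ≤ w) (hlight : ∀ S ∈ E, ∑ y ∈ S, Q y ≤ p)
    (hw0 : 0 ≤ w) (hA : 0 < A) (hN : 0 ≤ N) (hlarge : N ≤ A * #E → w < 2 * ∑ y ∈ supp E, Q y) :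
    w / 4 * (#E - N / A) ≤ ∑ S ∈ E, ∑ y ∈ supp E \ S, Q y := by
  rcases lt_or_ge (A * #E) N with hlt | hge
  · calc w / 4 * (#E - N / A) ≤ 0 :=
          mul_nonpos_of_nonneg_of_nonpos (by positivity)
            (sub_nonpos.2 ((le_div_iff₀' hA).2 hlt.le))
      _ ≤ ∑ S ∈ E, ∑ y ∈ supp E \ S, Q y := sum_nonneg fun S _ => sum_nonneg fun y _ => hQ y
  · calc w / 4 * (#E - N / A) ≤ w / 4 * #E := by gcongr; exact sub_le_self _ (by positivity)
      _ = ∑ _S ∈ E, w / 4 := by rw [sum_const, nsmul_eq_mul, mul_comm]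
      _ ≤ ∑ S ∈ E, ∑ y ∈ supp E \ S, Q y := sum_le_sum fun S hS => by
          have hsplit := sum_sdiff (f := Q) (subset_supp_of_mem hS)
          linarith [hlarge hge, hlight S hS]

theorem card_mul_pow_le_sum_card_avoiding [Fintype α] {E : Finset (Finset α)} {Q : α → ℝ} {p : ℝ}
    (hp : p ≤ ∑ y, Q y) (hE : ∀ S ∈ E, ∑ y ∈ S, Q y ≤ p) (r : ℕ) :
    #E * (∑ y, Q y - p) ^ r ≤ ∑ t : Fin r → α, (∏ j, Q (t j)) * #(avoiding E t) := by
  simp only [avoiding, sum_prod_mul_card_filter_forall E (fun S y => y ∉ S) Q r]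
  rw [← nsmul_eq_mul]
  refine card_nsmul_le_sum _ _ _ fun S hS => pow_le_pow_left₀ (sub_nonneg.2 hp) ?_ r
  have hsplit := sum_filter_add_sum_filter_not univ (· ∈ S) Q
  rw [filter_univ_mem] at hsplit
  linarith [hE S hS]

theorem succ_mul_mul_sub_le_of_forall_lt_two_mul_sum_supp [Fintype α] {E : Finset (Finset α)}
    {D : ℝ} (hE : ∀ T, IsTipSet E T → #T ≤ D) {Q : α → ℝ} (hQ : ∀ y, 0 ≤ Q y) {p w A : ℝ}
    (hlight : ∀ S ∈ E, ∑ y ∈ S, Q y ≤ p) (hw : ∑ y, Q y = w) (hpw : 4 * p ≤ w) (hA : 0 < A)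
    (hlarge : ∀ E' ⊆ E, #E ≤ A * #E' → w < 2 * ∑ y ∈ supp E', Q y) (r : ℕ) :
    (r + 1) * (w / 4 * (∑ t : Fin r → α, (∏ j, Q (t j)) * #(avoiding E t) - w ^ r * #E / A)) ≤
      D * (w * ∑ t : Fin r → α, (∏ j, Q (t j)) * #(avoiding E t)) := by
  have hw0 : 0 ≤ w := hw ▸ sum_nonneg fun y _ => hQ y
  calc (r + 1) * (w / 4 * (∑ t : Fin r → α, (∏ j, Q (t j)) * #(avoiding E t) - w ^ r * #E / A))
      = (r + 1) * ∑ t : Fin r → α, (∏ j, Q (t j)) * (w / 4 * (#(avoiding E t) - #E / A)) := by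
        simp only [mul_sub, sum_sub_distrib, mul_left_comm _ (w / 4), ← mul_sum, ← sum_mul,
          ← Fintype.sum_pow, hw]
        ring
    _ ≤ (r + 1) * ∑ t : Fin r → α, (∏ j, Q (t j)) *
          ∑ S ∈ avoiding E t, ∑ y ∈ supp (avoiding E t) \ S, Q y := by
        gcongr with t
        · exact prod_nonneg fun j _ => hQ _
        · exact mul_card_sub_le_sum_sum_supp_sdiff hQ hpw
            (fun S hS => hlight S (avoiding_subset E t hS)) hw0 hA
            (#E).cast_nonneg (hlarge _ (avoiding_subset E t))
    _ ≤ D * (w * ∑ t : Fin r → α, (∏ j, Q (t j)) * #(avoiding E t)) := by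
        refine (succ_mul_sum_avoiding_le hE hQ r).trans_eq ?_
        simp only [hw, mul_sum, mul_left_comm]

theorem exists_subset_card_le_pow_mul_two_mul_sum_supp_le [Fintype α] {E : Finset (Finset α)}
    {D : ℝ} (hE : ∀ T, IsTipSet E T → #T ≤ D) {Q : α → ℝ} (hQ : ∀ y, 0 ≤ Q y) {p w : ℝ}
    (hp : 0 < p) (hlight : ∀ S ∈ E, ∑ y ∈ S, Q y ≤ p) (hw : ∑ y, Q y = w) (hpw : 4 * p ≤ w) :
    ∃ E' ⊆ E, #E ≤ 2 * (w / (w - p)) ^ ⌊8 * D⌋₊ * #E' ∧ 2 * ∑ y ∈ supp E', Q y ≤ w := by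
  by_contra! hlarge
  set r := ⌊8 * D⌋₊
  have hwp : 0 < w - p := by linarith
  have hw0 : 0 < w := by linarith
  set A := 2 * (w / (w - p)) ^ r
  set M := ∑ t : Fin r → α, (∏ j, Q (t j)) * #(avoiding E t)
  have hA : 0 < A := by positivity
  have hEpos : 0 < (#E : ℝ) := by
    rw [Nat.cast_pos, card_pos, nonempty_iff_ne_empty]
    rintro rfl
    simpa [supp] using hw0.trans (hlarge ∅ (empty_subset _) (by simp))
  have hM : w ^ r * #E / A ≤ M / 2 := by
    calc w ^ r * #E / A = #E * (w - p) ^ r / 2 := by simp only [A, div_pow]; field_simp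
      _ ≤ M / 2 := by
          gcongr
          exact hw ▸ card_mul_pow_le_sum_card_avoiding (by linarith) hlight r
  have hM0 : 0 < M := by linarith [show 0 < w ^ r * #E / A by positivity]
  have hr : (r + 1) * (w * M / 8) ≤ 8 * D * (w * M / 8) := by
    calc (r + 1) * (w * M / 8) = (r + 1) * (w / 4 * (M - M / 2)) := by ring
      _ ≤ (r + 1) * (w / 4 * (M - w ^ r * #E / A)) := by gcongr
      _ ≤ D * (w * M) :=
          succ_mul_mul_sub_le_of_forall_lt_two_mul_sum_supp hE hQ hlight hw hpw hA hlarge r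
      _ = 8 * D * (w * M / 8) := by ring
  exact (Nat.lt_floor_add_one (8 * D)).not_ge (le_of_mul_le_mul_right hr (by positivity))

theorem div_sub_pow_floor_le_exp {p w κ : ℝ} (hp : 0 < p) (hpw : 4 * p ≤ w) (hκ : 0 ≤ κ) :
    (w / (w - p)) ^ ⌊8 * (κ * w)⌋₊ ≤ Real.exp (16 * κ * p) := by
  have hw : 0 < w := by linarith
  have hwp : 0 < w - p := by linarith
  calc (w / (w - p)) ^ ⌊8 * (κ * w)⌋₊ ≤ Real.exp (2 * p / w) ^ ⌊8 * (κ * w)⌋₊ := by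
        gcongr
        refine le_trans ?_ (Real.add_one_le_exp _)
        rw [div_add_one hw.ne', div_le_div_iff₀ hwp hw]
        nlinarith
    _ = Real.exp (⌊8 * (κ * w)⌋₊ * (2 * p / w)) := (Real.exp_nat_mul _ _).symm
    _ ≤ Real.exp (8 * (κ * w) * (2 * p / w)) := by
        gcongr
        exact Nat.floor_le (by positivity)
    _ = Real.exp (16 * κ * p) := by
        congr 1
        field_simp
        ring

theorem exists_subset_card_le_exp_mul_two_mul_sum_supp_le [Finite α] {E : Finset (Finset α)}
    {Q : α → ℝ} (hQ : ∀ y, 0 ≤ Q y) {p κ : ℝ} (hp : 0 < p) (hκ : 0 ≤ κ)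
    (hlight : ∀ S ∈ E, ∑ y ∈ S, Q y ≤ p) (hE : ∀ T, IsTipSet E T → #T ≤ κ * ∑ y ∈ supp E, Q y)
    (hpE : 4 * p ≤ ∑ y ∈ supp E, Q y) :
    ∃ E' ⊆ E, #E ≤ 2 * Real.exp (16 * κ * p) * #E' ∧
      2 * ∑ y ∈ supp E', Q y ≤ ∑ y ∈ supp E, Q y := by
  have := Fintype.ofFinite α
  let Q' (y : α) : ℝ := if y ∈ supp E then Q y else 0
  have hQ' (U : Finset α) (hU : U ⊆ supp E) : ∑ y ∈ U, Q' y = ∑ y ∈ U, Q y :=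
    sum_congr rfl fun y hy => if_pos (hU hy)
  obtain ⟨E', hE'E, hcard, hsupp⟩ := exists_subset_card_le_pow_mul_two_mul_sum_supp_le hE
    (Q := Q') (fun y => by positivity [hQ y]) hp
    (fun S hS => by rw [hQ' S (subset_supp_of_mem hS)]; exact hlight S hS)
    (by simp only [Q', sum_ite_mem, univ_inter]) hpE
  rw [hQ' _ (supp_mono hE'E)] at hsupp
  refine ⟨E', hE'E, hcard.trans ?_, hsupp⟩
  gcongr
  exact div_sub_pow_floor_le_exp hp hpE hκ

theorem card_le_pow_mul_of_sum_supp_le [Finite α] {G : Finset (Finset α)} {Q : α → ℝ}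
    (hQ : ∀ y, 0 ≤ Q y) {p κ C : ℝ} (hp : 0 < p) (hκ : 0 ≤ κ) (hlight : ∀ S ∈ G, ∑ y ∈ S, Q y ≤ p)
    (hG : ∀ E ⊆ G, ∀ T, IsTipSet E T → #T ≤ κ * ∑ y ∈ supp E, Q y)
    (hC : ∀ E ⊆ G, ∑ y ∈ supp E, Q y ≤ 4 * p → #E ≤ C) (j : ℕ) {E : Finset (Finset α)}
    (hEG : E ⊆ G) (hE : ∑ y ∈ supp E, Q y ≤ 2 ^ j * (4 * p)) :
    #E ≤ (2 * Real.exp (16 * κ * p)) ^ j * C := by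
  induction j generalizing E with
  | zero => simpa using hC E hEG (by simpa using hE)
  | succ j ih =>
    have hC0 : 0 ≤ C := by simpa using hC ∅ (empty_subset _) (by simpa [supp] using hp.le)
    have hfactor : 1 ≤ 2 * Real.exp (16 * κ * p) := by
      linarith [Real.one_le_exp (show 0 ≤ 16 * κ * p by positivity)]
    rcases le_total (∑ y ∈ supp E, Q y) (4 * p) with hsmall | hbig
    · calc (#E : ℝ) ≤ 1 * C := by rw [one_mul]; exact hC E hEG hsmall
        _ ≤ (2 * Real.exp (16 * κ * p)) ^ (j + 1) * C := by gcongr; exact one_le_pow₀ hfactor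
    · obtain ⟨E', hE'E, hcard, hsupp⟩ := exists_subset_card_le_exp_mul_two_mul_sum_supp_le hQ hp hκ
        (fun S hS => hlight S (hEG hS)) (hG E hEG) hbig
      rw [pow_succ] at hE
      calc (#E : ℝ) ≤ 2 * Real.exp (16 * κ * p) * #E' := hcard
        _ ≤ 2 * Real.exp (16 * κ * p) * ((2 * Real.exp (16 * κ * p)) ^ j * C) := by
            gcongr
            exact ih (hE'E.trans hEG) (by linarith)
        _ = (2 * Real.exp (16 * κ * p)) ^ (j + 1) * C := by ring

theorem card_le_exp_of_isTipSet_le [Fintype α] {E : Finset (Finset α)} {D l : ℝ}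
    (hE : ∀ T, IsTipSet E T → #T ≤ D) (hl : 0 < l) (hl1 : l ≤ 1) :
    #E ≤ Real.exp (D * Real.log (1 / l) + l * Fintype.card α) := by
  have hD : 0 ≤ D := by simpa using hE ∅ (isTipSet_empty E)
  have hvc : E.vcDim ≤ D := (Nat.le_floor_iff hD).1 <| Finset.sup_le fun T hT =>
    Nat.le_floor (hE T (isTipSet_of_shatters (mem_shatterer.1 hT)))
  have hlog : 0 ≤ Real.log (1 / l) := Real.log_nonneg (one_le_one_div hl hl1)
  calc (#E : ℝ) ≤ ∑ i ∈ Iic E.vcDim, ((Fintype.card α).choose i : ℝ) := by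
        exact_mod_cast (card_le_card_shatterer E).trans card_shatterer_le_sum_vcDim
    _ ≤ Real.exp (E.vcDim * Real.log (1 / l) + l * Fintype.card α) := sum_choose_Iic_le _ _ hl hl1
    _ ≤ Real.exp (D * Real.log (1 / l) + l * Fintype.card α) := by gcongr

theorem card_le_exp_of_sum_supp_le [Fintype α] {E : Finset (Finset α)} {Q : α → ℝ} {p κ a b : ℝ}
    (hκ : 0 ≤ κ) (ha : 0 ≤ a) (hb : 0 ≤ b) (hαa : Fintype.card α ≤ κ * 2 ^ a) (hpb : 1 ≤ p * 2 ^ b)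
    (hE : ∀ T, IsTipSet E T → #T ≤ 4 * κ * ∑ y ∈ supp E, Q y)
    (hEp : ∑ y ∈ supp E, Q y ≤ 4 * p) : #E ≤ Real.exp (16 * (κ * p) * (a + b) + κ * p) := by
  have hp : 0 ≤ p := (pos_of_mul_pos_left (one_pos.trans_le hpb) (by positivity)).le
  have htip (T : Finset α) (hT : IsTipSet E T) : #T ≤ 16 * (κ * p) :=
    (hE T hT).trans (by nlinarith)
  refine (card_le_exp_of_isTipSet_le (l := 2 ^ (-(a + b))) htip (by positivity)
    (Real.rpow_le_one_of_one_le_of_nonpos one_le_two (by linarith))).trans ?_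
  have hlog : Real.log (1 / 2 ^ (-(a + b))) ≤ a + b := by
    rw [one_div, ← Real.rpow_neg zero_le_two, neg_neg, Real.log_rpow two_pos]
    exact mul_le_of_le_one_right (by positivity) (by linarith [Real.log_two_lt_d9])
  have hcard : 2 ^ (-(a + b)) * (Fintype.card α : ℝ) ≤ κ * p := by
    calc 2 ^ (-(a + b)) * (Fintype.card α : ℝ) ≤ 2 ^ (-(a + b)) * (κ * 2 ^ a) * (p * 2 ^ b) :=
          (mul_le_mul_of_nonneg_left hαa (by positivity)).trans
            (le_mul_of_one_le_right (by positivity) hpb)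
      _ = κ * p := by
          rw [Real.rpow_neg zero_le_two, Real.rpow_add two_pos]
          field_simp
  gcongr

theorem subset_singleton_empty_of_forall_light {G : Finset (Finset α)} {Q : α → ℝ} {p κ : ℝ}
    (hκ : 0 ≤ κ) (hκp : κ * p < 1) (hlight : ∀ S ∈ G, ∑ y ∈ S, Q y ≤ p)
    (hG : ∀ E ⊆ G, ∀ T, IsTipSet E T → #T ≤ κ * ∑ y ∈ supp E, Q y) : G ⊆ {∅} := fun S hS => by
  rw [mem_singleton, ← not_nonempty_iff_eq_empty]
  rintro ⟨x, hx⟩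
  have htip : IsTipSet {S} {x} := fun y hy =>
    ⟨S, mem_singleton_self S, by rw [mem_singleton.1 hy, inter_singleton_of_mem hx]⟩
  have hκS := hG {S} (singleton_subset_iff.2 hS) {x} htip
  rw [supp, singleton_biUnion, card_singleton, Nat.cast_one] at hκS
  exact (hκS.trans (mul_le_mul_of_nonneg_left (hlight S hS) hκ)).not_gt hκp

theorem one_le_two_pow_floor_mul {p b : ℝ} (hp : 0 < p) (hpb : 1 ≤ p * 2 ^ b) :
    1 ≤ 2 ^ ⌊b⌋₊ * (4 * p) := by
  have hpow : (2 : ℝ) ^ b ≤ 2 ^ (⌊b⌋₊ + 1) := by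
    rw [← Real.rpow_natCast, Nat.cast_succ]
    exact Real.rpow_le_rpow_of_exponent_le one_le_two (Nat.lt_floor_add_one b).le
  calc 1 ≤ p * 2 ^ b := hpb
    _ ≤ p * 2 ^ (⌊b⌋₊ + 1) := by gcongr
    _ = 2 ^ ⌊b⌋₊ * (2 * p) := by ring
    _ ≤ 2 ^ ⌊b⌋₊ * (4 * p) := by gcongr; norm_num

theorem two_mul_exp_pow_floor_le_exp {x b : ℝ} (hx : 1 ≤ 4 * x) (hb : 0 ≤ b) :
    (2 * Real.exp (64 * x)) ^ ⌊b⌋₊ ≤ Real.exp (68 * x * b) := by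
  calc (2 * Real.exp (64 * x)) ^ ⌊b⌋₊ ≤ (Real.exp (4 * x) * Real.exp (64 * x)) ^ ⌊b⌋₊ := by
        gcongr
        linarith [Real.add_one_le_exp (4 * x)]
    _ = Real.exp (68 * x * ⌊b⌋₊) := by
        rw [← Real.exp_add, ← Real.exp_nat_mul]
        ring_nf
    _ ≤ Real.exp (68 * x * b) := by
        gcongr
        · linarith
        · exact Nat.floor_le hb

theorem card_le_exp_of_forall_light [Fintype α] {G : Finset (Finset α)} {Q : α → ℝ}
    (hQ : Q ∈ stdSimplex ℝ α) {p κ a b : ℝ} (hκ : 0 ≤ κ) (ha : 1 ≤ a) (hb : 1 ≤ b)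
    (hαa : Fintype.card α ≤ κ * 2 ^ a) (hpb : 1 ≤ p * 2 ^ b)
    (hlight : ∀ S ∈ G, ∑ y ∈ S, Q y ≤ p)
    (hG : ∀ E ⊆ G, ∀ T, IsTipSet E T → #T ≤ 4 * κ * ∑ y ∈ supp E, Q y) :
    #G ≤ Real.exp (101 * (κ * a * (p * b))) := by
  have hp : 0 < p := pos_of_mul_pos_left (one_pos.trans_le hpb) (by positivity)
  rcases lt_or_ge (4 * κ * p) 1 with hκp | hκp
  · have hG0 := subset_singleton_empty_of_forall_light (by positivity) hκp hlight hG
    calc (#G : ℝ) ≤ 1 := by simpa using card_le_card hG0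
      _ ≤ Real.exp (101 * (κ * a * (p * b))) := Real.one_le_exp (by positivity)
  have hG1 : ∑ y ∈ supp G, Q y ≤ 2 ^ ⌊b⌋₊ * (4 * p) :=
    (sum_le_univ_sum_of_nonneg hQ.1).trans (hQ.2.trans_le (one_le_two_pow_floor_mul hp hpb))
  calc (#G : ℝ) ≤ (2 * Real.exp (16 * (4 * κ) * p)) ^ ⌊b⌋₊ *
          Real.exp (16 * (κ * p) * (a + b) + κ * p) := by
        refine card_le_pow_mul_of_sum_supp_le hQ.1 hp (by positivity) hlight hG
          (fun E hE => ?_) _ Subset.rfl hG1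
        exact card_le_exp_of_sum_supp_le hκ (by positivity) (by positivity) hαa hpb (hG E hE)
    _ = (2 * Real.exp (64 * (κ * p))) ^ ⌊b⌋₊ *
          Real.exp (16 * (κ * p) * (a + b) + κ * p) := by ring_nf
    _ ≤ Real.exp (68 * (κ * p) * b) * Real.exp (16 * (κ * p) * (a + b) + κ * p) := by
        gcongr
        exact two_mul_exp_pow_floor_le_exp (by linarith) (by positivity)
    _ = Real.exp (κ * p * (68 * b + 16 * (a + b) + 1)) := by
        rw [← Real.exp_add]
        ring_nf
    _ ≤ Real.exp (κ * p * (101 * (a * b))) := by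
        gcongr
        nlinarith
    _ = Real.exp (101 * (κ * a * (p * b))) := by ring_nf

theorem MoonflowerFree.almostCovered [Fintype α] [Nonempty α] {k : ℕ} {F : Finset (Finset α)}
    (hF : MoonflowerFree k F) {p u v : ℝ} (hu : 2 ≤ u) (hv : 2 ≤ v)
    (hαu : Fintype.card α ≤ k * u) (hpv : 1 ≤ p * v) :
    AlmostCovered p (2 ^ (202 * k * Real.logb 2 u * (p * Real.logb 2 v))) F := by
  intro J
  obtain ⟨Q, hQ, hQJ⟩ := exists_stdSimplex_forall_isTipSet (G := proj F J) (D := k) fun T hT =>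
    Nat.cast_le.2 (hF.card_lt_of_isTipSet hT.of_proj).le
  refine ⟨{S ∈ proj F J | ∑ y ∈ S, Q y < p}, filter_subset _ _, ?_, Q, hQ, fun S hS => ?_⟩
  · have one_le_logb {x : ℝ} (hx : 2 ≤ x) : 1 ≤ Real.logb 2 x :=
      (Real.le_logb_iff_rpow_le one_lt_two (by linarith)).2 (by simpa using hx)
    have hp : 0 < p := pos_of_mul_pos_left (one_pos.trans_le hpv) (by linarith)
    have ha := one_le_logb hu
    have hb := one_le_logb hv
    set a := Real.logb 2 u
    set b := Real.logb 2 v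
    have hua : 2 ^ a = u := Real.rpow_logb two_pos (by norm_num) (by linarith)
    have hvb : 2 ^ b = v := Real.rpow_logb two_pos (by norm_num) (by linarith)
    calc _ ≤ Real.exp (101 * (k * a * (p * b))) :=
          card_le_exp_of_forall_light hQ k.cast_nonneg ha hb (hua ▸ hαu) (hvb ▸ hpv)
            (fun S hS => (mem_filter.1 hS).2.le) fun E hE => hQJ E (hE.trans (filter_subset _ _))
      _ = Real.exp (1 / 2 * (202 * k * a * (p * b))) := by ring_nf
      _ ≤ Real.exp (Real.log 2 * (202 * k * a * (p * b))) := by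
          gcongr
          linarith [Real.log_two_gt_d9]
      _ = 2 ^ (202 * k * a * (p * b)) := (Real.rpow_def_of_pos two_pos _).symm
  · simpa [(mem_sdiff.1 hS).1] using (mem_sdiff.1 hS).2

end Moonflower

theorem lemma1p10_general :
    ∃ B : ℝ, 1 ≤ B ∧
      ∀ {α : Type*} [Fintype α] [DecidableEq α] (k : ℕ) (p : ℝ) (F : Finset (Finset α)),
        k ≤ Fintype.card α → 0 < p → p ≤ 1 → Moonflower.MoonflowerFree k F →
        (2 * k ≤ Fintype.card α → p ≤ 1 / 2 →
          Moonflower.AlmostCovered p ((2 : ℝ) ^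
            (B * k * Real.logb 2 (Fintype.card α / k) * (p * Real.logb 2 (1 / p)))) F) ∧
        Moonflower.AlmostCovered p ((2 : ℝ) ^
          (B * k * Real.logb 2 (Real.exp 1 * Fintype.card α / k) *
            (p * Real.logb 2 (2 / p)))) F := by
  refine ⟨202, by norm_num, fun {α} _ _ k p F hkα hp hp1 hF => ?_⟩
  have hk : 0 < k := Nat.pos_of_ne_zero fun h => by
    subst h
    exact hF Fin.elim0 (fun i => i.elim0) ⟨∅, fun i => i.elim0, fun i => i.elim0⟩
  have := Fintype.card_pos_iff.1 (hk.trans_le hkα)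
  have hkR : (0 : ℝ) < k := Nat.cast_pos.2 hk
  have hkαR : (k : ℝ) ≤ Fintype.card α := Nat.cast_le.2 hkα
  have two_le_exp : 2 ≤ Real.exp 1 := by linarith [Real.add_one_le_exp 1]
  refine ⟨fun h2k hp2 => hF.almostCovered ?_ ?_ ?_ ?_, hF.almostCovered ?_ ?_ ?_ ?_⟩
  · rw [le_div_iff₀ hkR]
    exact_mod_cast h2k
  · rwa [le_div_comm₀ two_pos hp]
  · rw [mul_div_cancel₀ _ hkR.ne']
  · rw [mul_one_div_cancel hp.ne']
  · rw [le_div_iff₀ hkR]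
    gcongr
  · rw [le_div_iff₀ hp]
    linarith
  · rw [mul_div_cancel₀ _ hkR.ne']
    exact le_mul_of_one_le_left (by positivity) (by linarith)
  · rw [mul_div_cancel₀ _ hp.ne']
    exact one_le_two

theorem lemma1p10 :
    ∃ B : ℝ, 1 ≤ B ∧
      ∀ (n k w : ℕ) (p : ℝ) (F : Finset (Finset (Fin n))),
        1 ≤ k → k ≤ n → 0 < p → p < 1 →
        (∀ S ∈ F, S.card ≤ w) →
        Moonflower.MoonflowerFree k F →
        (Moonflower.supp F).card = n →
        (2 * k ≤ n → p ≤ 1 / 2 →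
          Moonflower.AlmostCovered p
            ((2 : ℝ) ^ (B * k * Real.logb 2 ((n : ℝ) / k) * (p * Real.logb 2 (1 / p)))) F) ∧
        Moonflower.AlmostCovered p
          ((2 : ℝ) ^ (B * k * Real.logb 2 (Real.exp 1 * n / k) * (p * Real.logb 2 (2 / p)))) F := by
  obtain ⟨B, hB, h⟩ := lemma1p10_general
  exact ⟨B, hB, fun n k _ p F _ hkn hp hp1 _ hF _ => by
    simpa only [Fintype.card_fin] using h k p F (by simpa using hkn) hp hp1.le hF⟩
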